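/- Let $f :\subseteq \{0,1\}^{\mathbb{N}} \to \{0,1\}^{\mathbb{N}}$ be an arbitrary partial function. For $\mathcal{X} \in \{\{0,1\}^{\mathbb{N}}, \mathbb{N}^{\mathbb{N}}\}$ let $(U_n)_{n\in\mathbb{N}}$ be the standard total effective enumeration of the computably open subsets of $\mathcal{X}$, where $U_n$ is the union of the cylinders given by the words in the $n$-th computably enumerable set of words. A set $D \subseteq \operatorname{dom}(f)$ is a computably $\Delta^0_2$ subset of the subspace $\operatorname{dom}(f)$ if $D=\bigcup_{i} A_i=\bigcap_{i} V_i$ for a computable sequence $(A_i)_i$ of computably closed and a computable sequence $(V_i)_i$ of computably open subsets of $\operatorname{dom}(f)$ (in the relative topology); let $(D_n)_n$ be the standard effective partial enumeration of these sets, where the index $n$ encodes the two computable sequences and is valid if and only if the union and the intersection agree. The function $f$ is called Markov-effectively $\Delta^0_2$-measurable if there is a partial computable function $P :\subseteq \mathbb{N}\to\mathbb{N}$ such that for every $n$, $P(n)$ is defined and is a valid index with $D_{P(n)} = f^{-1}(U_n)$, where $(U_n)_n$ enumerates the computably open subsets of $\{0,1\}^{\mathbb{N}}$. Let $J : \mathbb{N}^{\mathbb{N}}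 \to \mathbb{N}^{\mathbb{N}}$ be the Turing jump, $J(q)(n) = 1$ if $q \in U_n$ and $J(q)(n)=0$ otherwise, with $(U_n)_n$ the enumeration for $\mathbb{N}^{\mathbb{N}}$. Let $\mathfrak{L} :\subseteq \mathcal{C}(\mathbb{N},\mathbb{N}^{\mathbb{N}}) \to \mathbb{N}^{\mathbb{N}}$ be the partial function given by $\mathfrak{L}((p_i)_{i\in\mathbb{N}}) = q$ if and only if $\lim_{i\to\infty} p_i = J(q)$ in $\mathbb{N}^{\mathbb{N}}$. All spaces carry their standard representations by names in $\{0,1\}^{\mathbb{N}}$. A realizer of a partial function $g$ between represented spaces is a partial function on $\{0,1\}^{\mathbb{N}}$ that sends each name of each point $x \in \operatorname{dom}(g)$ to a name of $g(x)$. Strong Weihrauch reducibility $f \leq_{sW} g$ means that there are (Type-2) computable $H, K :\subseteq \{0,1\}^{\mathbb{N}} \to \{0,1\}^{\mathbb{N}}$ such that $H \circ G \circ K$ is a realizer of $f$ for every realizer $G$ of $g$. Then $f$ is Markov-effectively $\Delta^0_2$-measurable if and only if $f \leq_{sW} \mathfrak{L}$. -/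

import Mathlib

/-! ### Type-2 computability, Weihrauch reducibility and Markov-effective measurability -/

namespace TTE

/-- Cantor space `{0,1}^ℕ`. -/
abbrev Cantor : Type := ℕ → Bool

/-- Baire space `ℕ^ℕ`. -/
abbrev Baire : Type := ℕ → ℕ

/-- The finite word `p(0) p(1) … p(k-1)`. -/
def initSeg {α : Type} (p : ℕ → α) (k : ℕ) : List α := (List.range k).map p

/-- Type-2 computability of a partial function `F` on Cantor space: a computable, prefix-monotone
function `M` on finite words (what the machine has written after reading a finite part of its
input) approximates `F`. On every `p` in the domain of `F` the words `M (initSeg p k)` grow to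
the infinite sequence `F p`; nothing is required outside the domain. -/
def IsComputable (F : Cantor →. Cantor) : Prop :=
  ∃ M : List Bool → List Bool, Computable M ∧
    (∀ u v : List Bool, u <+: v → M u <+: M v) ∧
    ∀ p q : Cantor, q ∈ F p → ∀ n : ℕ, ∃ k : ℕ, initSeg q n <+: M (initSeg p k)

/-- A representation of `X`: a partial surjection from Cantor space onto `X`. -/
structure Representation (X : Type) where
  /-- the partial map sending a name to the point it denotes -/
  toPFun : Cantor →. X
  /-- every point has a name -/
  surj : ∀ x : X, ∃ p : Cantor, x ∈ toPFun p

/-- The representation in which `x` has the single name `e x`, for an injection `e`. -/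
noncomputable def Representation.ofInjective {X : Type} (e : X → Cantor)
    (he : Function.Injective e) : Representation X where
  toPFun := fun r => ⟨∃ x, e x = r, fun h => h.choose⟩
  surj := fun x => ⟨e x, ⟨x, rfl⟩, he (Exists.choose_spec (⟨x, rfl⟩ : ∃ y, e y = e x))⟩

theorem Representation.mem_ofInjective {X : Type} (e : X → Cantor) (he : Function.Injective e)
    (r : Cantor) (x : X) : x ∈ (Representation.ofInjective e he).toPFun r ↔ e x = r := by
  constructor
  · rintro ⟨h, rfl⟩
    exact h.choose_spec
  · intro hx
    exact ⟨⟨x, hx⟩, he ((Exists.choose_spec (⟨x, hx⟩ : ∃ y, e y = r)).trans hx.symm)⟩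

/-- The characteristic function of the graph of `p`. -/
def graphName (p : Baire) : Cantor := fun k => decide (p k.unpair.1 = k.unpair.2)

theorem graphName_injective : Function.Injective graphName := by
  intro p q h
  funext n
  have h1 := congrFun h (Nat.pair n (p n))
  simpa [graphName, eq_comm] using h1

/-- The join of a sequence of points of Baire space. -/
def join (p : ℕ → Baire) : Baire := fun k => p k.unpair.1 k.unpair.2

theorem join_injective : Function.Injective join := by
  intro p q h
  funext i n
  have h1 := congrFun h (Nat.pair i n)
  simpa [join] using h1

/-- Cantor space, represented by the identity. -/
noncomputable def reprCantor : Representation Cantor :=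
  Representation.ofInjective id Function.injective_id

/-- Baire space: the name of `p` is the characteristic function of the graph of `p`. -/
noncomputable def reprBaire : Representation Baire :=
  Representation.ofInjective graphName graphName_injective

/-- Sequences in Baire space, that is (continuous) functions from `ℕ` to `ℕ^ℕ`: the name of a
sequence is the name of its join. -/
noncomputable def reprBaireSeq : Representation (ℕ → Baire) :=
  Representation.ofInjective (graphName ∘ join) (graphName_injective.comp join_injective)

/-- A partial multivalued function from `X` to `Y`: `f x` is the set of admissible values, and the
domain of `f` consists of those `x` for which `f x` is nonempty. -/
abbrev MultiMap (X Y : Type) : Type := X → Set Y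

/-- A partial function as a partial multivalued one. -/
def toMulti {X Y : Type} (f : X →. Y) : MultiMap X Y := fun x => {y | y ∈ f x}

/-- `F` realizes `f`: it sends every name of a point `x` in the domain of `f` to a name of some
value in `f x`. -/
def IsRealizer {X Y : Type} (δX : Representation X) (δY : Representation Y)
    (F : Cantor →. Cantor) (f : MultiMap X Y) : Prop :=
  ∀ (p : Cantor) (x : X), x ∈ δX.toPFun p → (f x).Nonempty →
    ∃ q ∈ F p, ∃ y ∈ δY.toPFun q, y ∈ f x

/-- Strong Weihrauch reducibility `f ≤_sW g`. -/
def StrongWeihrauchLE {X Y U V : Type}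
    (δX : Representation X) (δY : Representation Y) (δU : Representation U) (δV : Representation V)
    (f : MultiMap X Y) (g : MultiMap U V) : Prop :=
  ∃ H K : Cantor →. Cantor, IsComputable H ∧ IsComputable K ∧
    ∀ G : Cantor →. Cantor, IsRealizer δU δV G g → IsRealizer δX δY (H.comp (G.comp K)) f

/-- `WDom n a`: the `n`-th partial recursive function is defined at (the code of) `a`. -/
def WDom {α : Type} [Primcodable α] (n : ℕ) (a : α) : Prop :=
  (Nat.Partrec.Code.eval (Denumerable.ofNat Nat.Partrec.Code n) (Encodable.encode a)).Dom

/-- The effective enumeration `(U_n)` of the computably open subsets of `α^ℕ`: `U_n` is the union of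
the cylinders given by the words in the `n`-th computably enumerable set of words. -/
def openSet {α : Type} [Primcodable α] (n : ℕ) : Set (ℕ → α) :=
  {p | ∃ k : ℕ, WDom n (initSeg p k)}

/-- The `n`-th computable sequence of computably open subsets of Cantor space. -/
def openSeq (n i : ℕ) : Set Cantor :=
  {p | ∃ k : ℕ, WDom n (i, initSeg p k)}

/-- `IsDeltaIndex X n D`: in the effective partial enumeration of the computably `Δ⁰₂` subsets of
the subspace `X` of Cantor space, the index `n = ⟨a, b⟩` is valid and denotes `D`. Here `a` gives a
computable sequence of closed sets `A_i` (through their complements) and `b` a computable sequence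
of open sets `U_i` of `X`, and `D = ⋃ i, A_i = ⋂ i, U_i`. -/
def IsDeltaIndex (X : Set Cantor) (n : ℕ) (D : Set Cantor) : Prop :=
  D = {p | p ∈ X ∧ ∃ i : ℕ, p ∉ openSeq n.unpair.1 i} ∧
    D = {p | p ∈ X ∧ ∀ i : ℕ, p ∈ openSeq n.unpair.2 i}

/-- Markov-effective `Δ⁰₂`-measurability of a partial function on Cantor space: some partial
computable `P` sends each index of an open set to an index, relative to the subspace `dom f`, of
its preimage. -/
def IsMarkovDeltaMeasurable (f : Cantor →. Cantor) : Prop :=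
  ∃ P : ℕ →. ℕ, Nat.Partrec P ∧
    ∀ n : ℕ, ∃ m ∈ P n, IsDeltaIndex f.Dom m (f.preimage (openSet n))

open Classical in
/-- The Turing jump: `J(q)(n) = 1` if `q ∈ U_n`, and `J(q)(n) = 0` otherwise. -/
noncomputable def jump (q : Baire) : Baire := fun n => if q ∈ openSet n then 1 else 0

/-- The map `𝔏`: a sequence converging (in Baire space) to `J(q)` is sent to `q`. -/
def lowMap : MultiMap (ℕ → Baire) Baire :=
  fun p => {q | Filter.Tendsto p Filter.atTop (nhds (jump q))}

end TTE

/-! Both conditions say that membership of `p ∈ dom f` in the preimages `f⁻¹(U_n)` is decidable in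
the limit, uniformly in `n`. A `Δ⁰₂` index for `⋃ i, A_i = ⋂ i, V_i` yields guesses: answer yes if,
for some `l`, the point has not yet been seen to leave `A_l` but has been seen to enter
`V_0, …, V_l`. Conversely, guesses yield the closed sets `A_i`, where all guesses from stage `i` on
are yes, and the open sets `V_i`, where some guess from stage `i` on is yes.

The guesses for all `n` at `p`, with indices translated to Baire space, form a sequence that
converges to the jump of `f p`; since the jump is injective, `𝔏` recovers `f p` from it. Conversely,
if `f = H ∘ 𝔏 ∘ K` on names, then `f p ∈ U_n` says that `q = 𝔏 (K p)` lies in an open set whose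
index is computable from `n`, so this is one bit of the jump of `q`, which is the limit of the
sequence named by `K p`. -/

namespace TTE

open Nat.Partrec (Code)
open Encodable Denumerable Filter

section Closure

variable {α β : Type*} [Primcodable α] [Primcodable β]

theorem primrecRel_exists_lt {R : ℕ → β → Prop} (hR : PrimrecRel R) :
    PrimrecRel fun (n : ℕ) (b : β) => ∃ k < n, R k b :=
  (hR.exists_mem_list.comp (Primrec.list_range.comp Primrec.fst) Primrec.snd).of_eq (by simp)

theorem primrecRel_forall_lt {R : ℕ → β → Prop} (hR : PrimrecRel R) :
    PrimrecRel fun (n : ℕ) (b : β) => ∀ k < n, R k b :=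
  (hR.forall_mem_list.comp (Primrec.list_range.comp Primrec.fst) Primrec.snd).of_eq (by simp)

theorem computable_map_range {f : α → ℕ} {g : α → ℕ → β} (hf : Computable f)
    (hg : Computable₂ g) :
    Computable fun a => (List.range (f a)).map (g a) := by
  have hstep : Computable₂ fun (a : α) (s : ℕ × List β) => s.2 ++ [g a s.1] :=
    Computable.list_concat.comp (.comp .snd .snd) (hg.comp .fst (.comp .fst .snd))
  refine (Computable.nat_rec hf (.const []) hstep).of_eq fun a => ?_
  induction f a with
  | zero => rfl
  | succ n ih => simp only [List.range_succ, List.map_append, List.map_singleton, ← ih]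

theorem computablePred_comp {p : β → Prop} {f : α → β} (hp : ComputablePred p)
    (hf : Computable f) : ComputablePred fun a => p (f a) :=
  have ⟨_, h⟩ := hp
  ⟨inferInstance, h.comp hf⟩

theorem rePred_exists {p : α → ℕ → Prop} (hp : ComputablePred fun x : α × ℕ => p x.1 x.2) :
    REPred fun a => ∃ k, p a k := by
  classical
  have hsearch : Partrec fun a => Nat.rfind fun k => Part.some (decide (p a k)) :=
    Partrec.rfind (p := fun a k => Part.some (decide (p a k))) hp.decide.partrec
  exact hsearch.dom_re.of_eq fun a => Nat.rfind_dom.trans (by simp)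

end Closure

section Halting

variable {α β : Type} [Primcodable α] [Primcodable β]

/-- The computation of the `n`-th partial recursive function at `a` is found to halt when searched
with the bound `k`; these are the decidable stages of the semidecidable predicate `WDom`. -/
def HaltsBy (k n : ℕ) (a : α) : Prop :=
  (Code.evaln k (ofNat Code n) (encode a)).isSome

theorem HaltsBy.mono {k k' n : ℕ} {a : α} (hk : k ≤ k') (h : HaltsBy k n a) : HaltsBy k' n a := by
  obtain ⟨x, hx⟩ := Option.isSome_iff_exists.1 h
  exact Option.isSome_iff_exists.2 ⟨x, Code.evaln_mono hk hx⟩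

theorem wDom_iff_exists_haltsBy {n : ℕ} {a : α} : WDom n a ↔ ∃ k, HaltsBy k n a := by
  simp only [WDom, Part.dom_iff_mem, Code.evaln_complete, HaltsBy, Option.isSome_iff_exists]
  exact exists_comm

theorem primrecPred_haltsBy : PrimrecPred fun x : (ℕ × ℕ) × α => HaltsBy x.1.1 x.1.2 x.2 := by
  have heval : Primrec fun x : (ℕ × ℕ) × α => Code.evaln x.1.1 (ofNat Code x.1.2) (encode x.2) :=
    Code.primrec_evaln.comp <| .pair
      (.pair (.comp .fst .fst) ((Primrec.ofNat Code).comp (.comp .snd .fst)))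
      (Primrec.encode.comp .snd)
  exact Primrec.eq.comp (Primrec.option_isSome.comp heval) (.const true)

theorem exists_computable_wDom_iff {R : β → α → Prop} (hR : REPred fun x : β × α => R x.1 x.2) :
    ∃ s : β → ℕ, Computable s ∧ ∀ b a, WDom (s b) a ↔ R b a := by
  obtain ⟨c, hc⟩ := Code.exists_code.1 hR
  refine ⟨fun b => encode (c.curry (encode b)), ?_, fun b a => ?_⟩
  · exact Computable.encode.comp
      (Code.primrec₂_curry.to_comp.comp (Computable.const c) Computable.encode)
  · have hpair : Nat.pair (encode b) (encode a) = encode (b, a) := by simp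
    rw [WDom, ofNat_encode, Code.eval_curry, hc, hpair]
    simp [Part.assert]

end Halting

section Words

variable {α β γ : Type}

theorem length_initSeg (p : ℕ → α) (k : ℕ) : (initSeg p k).length = k := by
  simp [initSeg]

theorem getElem?_initSeg {p : ℕ → α} {k i : ℕ} (h : i < k) : (initSeg p k)[i]? = some (p i) := by
  simp [initSeg, h]

theorem getElem?_initSeg_eq_some {p : ℕ → α} {k i : ℕ} {a : α} :
    (initSeg p k)[i]? = some a ↔ i < k ∧ p i = a := by
  simp [initSeg, List.getElem?_eq_some_iff]

theorem take_initSeg {p : ℕ → α} {k i : ℕ} (h : i ≤ k) : (initSeg p k).take i = initSeg p i := by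
  simp [initSeg, ← List.map_take, List.take_range, h]

theorem map_initSeg (g : α → β) (p : ℕ → α) (k : ℕ) :
    (initSeg p k).map g = initSeg (g ∘ p) k := by
  simp [initSeg]

theorem initSeg_prefix {p : ℕ → α} {j k : ℕ} (h : j ≤ k) : initSeg p j <+: initSeg p k :=
  take_initSeg (p := p) h ▸ List.take_prefix _ _

theorem eq_initSeg_of_prefix {p : ℕ → α} {w : List α} {k : ℕ} (h : w <+: initSeg p k) :
    w = initSeg p w.length := by
  have hl : w.length ≤ k := length_initSeg p k ▸ h.length_le
  rw [← take_initSeg hl]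
  exact List.prefix_iff_eq_take.1 h

theorem exists_initSeg_eq [Inhabited α] (w : List α) : ∃ p : ℕ → α, initSeg p w.length = w :=
  ⟨fun i => w.getD i default, List.ext_getElem (by simp [initSeg]) (by simp +contextual [initSeg])⟩

/-- The word function `M` computes `q` from `p`: it maps the initial segments of `p` to longer and
longer initial segments of `q`. In contrast to `IsComputable`, nothing is asked of `M` on words that
are not initial segments of `p`. -/
structure Computes (M : List α → List β) (p : ℕ → α) (q : ℕ → β) : Prop where
  eq_initSeg : ∀ k, M (initSeg p k) = initSeg q (M (initSeg p k)).length
  tendsto_length : Tendsto (fun k => (M (initSeg p k)).length) atTop atTop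

theorem Computes.comp {M : List α → List β} {N : List β → List γ} {p : ℕ → α} {q : ℕ → β}
    {r : ℕ → γ} (hN : Computes N q r) (hM : Computes M p q) : Computes (N ∘ M) p r where
  eq_initSeg k := by
    rw [Function.comp_apply, hM.eq_initSeg]
    exact hN.eq_initSeg _
  tendsto_length := by
    refine (hN.tendsto_length.comp hM.tendsto_length).congr fun k => ?_
    rw [Function.comp_apply, Function.comp_apply, ← hM.eq_initSeg]

theorem computes_map (g : α → β) (p : ℕ → α) : Computes (List.map g) p (g ∘ p) where
  eq_initSeg k := by rw [map_initSeg, length_initSeg]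
  tendsto_length := by simpa only [map_initSeg, length_initSeg] using! tendsto_id

end Words

section Machines

theorem IsComputable.exists_computes {F : Cantor →. Cantor} (hF : IsComputable F) :
    ∃ M : List Bool → List Bool, Computable M ∧ ∀ p, ∀ q ∈ F p, Computes M p q := by
  obtain ⟨M, hM, hmono, hgrow⟩ := hF
  refine ⟨M, hM, fun p q hq => ⟨fun k => ?_, ?_⟩⟩
  · obtain ⟨j, hj⟩ := hgrow p q hq (M (initSeg p k)).length
    have hk : M (initSeg p k) <+: M (initSeg p (max j k)) :=
      hmono _ _ (initSeg_prefix (le_max_right j k))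
    have hq := hj.trans (hmono _ _ (initSeg_prefix (le_max_left j k)))
    exact (List.prefix_of_prefix_length_le hk hq (length_initSeg _ _).ge).eq_of_length
      (length_initSeg _ _).symm
  · refine tendsto_atTop_atTop_of_monotone
      (fun j k hjk => (hmono _ _ (initSeg_prefix hjk)).length_le) fun n => ?_
    obtain ⟨k, hk⟩ := hgrow p q hq n
    exact ⟨k, length_initSeg q n ▸ hk.length_le⟩

theorem isComputable_of_bit {F : Cantor → Cantor} {N : ℕ → ℕ} {b : List Bool → ℕ → Bool}
    (hN : Computable N) (hNmono : Monotone N) (hNtop : ∀ n, ∃ l, n ≤ N l) (hb : Computable₂ b)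
    (hF : ∀ p l, ∀ k < N l, b (initSeg p l) k = F p k) : IsComputable (F : Cantor →. Cantor) := by
  let M (u : List Bool) : List Bool := (List.range (N u.length)).map (b u)
  have hM (p : Cantor) (l : ℕ) : M (initSeg p l) = initSeg (F p) (N l) := by
    simp only [M, length_initSeg]
    exact List.map_congr_left fun k hk => hF p l k (List.mem_range.1 hk)
  refine ⟨M, computable_map_range (hN.comp .list_length) hb, fun u v huv => ?_, ?_⟩
  · obtain ⟨p, hv⟩ := exists_initSeg_eq v
    have hu : u = initSeg p u.length := eq_initSeg_of_prefix (hv.symm ▸ huv)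
    rw [hu, ← hv, hM, hM]
    exact initSeg_prefix (hNmono huv.length_le)
  · intro p q hq n
    obtain rfl : q = F p := by simpa using hq
    obtain ⟨l, hl⟩ := hNtop n
    exact ⟨l, hM p l ▸ initSeg_prefix hl⟩

end Machines

section OpenSets

variable {α β : Type} [Primcodable α] [Primcodable β]

theorem exists_computable_mem_openSet_iff {M : List α → List β} (hM : Computable M) :
    ∃ s : ℕ → ℕ, Computable s ∧
      ∀ n p q, Computes M p q → (p ∈ openSet (s n) ↔ q ∈ openSet n) := by
  have hR : REPred fun x : ℕ × List α =>
      ∃ k : ℕ, HaltsBy k.unpair.1 x.1 ((M x.2).take k.unpair.2) := by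
    refine rePred_exists (computablePred_comp primrecPred_haltsBy.computablePred
      (f := fun x : (ℕ × List α) × ℕ => ((x.2.unpair.1, x.1.1), (M x.1.2).take x.2.unpair.2)) ?_)
    have hk : Computable fun x : (ℕ × List α) × ℕ => x.2.unpair := Computable.unpair.comp .snd
    exact .pair (.pair (.comp .fst hk) (.comp .fst .fst))
      (Primrec.list_take.to_comp.comp (.comp .snd hk) (hM.comp (.comp .snd .fst)))
  obtain ⟨s, hs, h⟩ := exists_computable_wDom_iff
    (R := fun n u => ∃ k : ℕ, HaltsBy k.unpair.1 n ((M u).take k.unpair.2)) hR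
  refine ⟨s, hs, fun n p q hpq => ?_⟩
  simp only [openSet, Set.mem_ofPred_eq, h]
  constructor
  · rintro ⟨k, m, hm⟩
    have hpre : (M (initSeg p k)).take m.unpair.2 <+: initSeg q (M (initSeg p k)).length :=
      hpq.eq_initSeg k ▸ List.take_prefix _ _
    exact ⟨_, wDom_iff_exists_haltsBy.2 ⟨_, eq_initSeg_of_prefix hpre ▸ hm⟩⟩
  · rintro ⟨k, hk⟩
    obtain ⟨m, hm⟩ := wDom_iff_exists_haltsBy.1 hk
    obtain ⟨l, hl⟩ := (hpq.tendsto_length.eventually_ge_atTop k).exists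
    refine ⟨l, Nat.pair m k, ?_⟩
    rwa [Nat.unpair_pair, hpq.eq_initSeg, take_initSeg hl]

end OpenSets

section Jump

theorem exists_mem_openSet_iff_apply_eq {α : Type} [Primcodable α] (i : ℕ) (a : α) :
    ∃ n, ∀ p : ℕ → α, p ∈ openSet n ↔ p i = a := by
  classical
  have hR : PrimrecPred fun x : ℕ × List α => x.2[i]? = some a :=
    Primrec.eq.comp (Primrec.list_getElem?.comp .snd (.const i)) (.const (some a))
  obtain ⟨s, -, hs⟩ := exists_computable_wDom_iff (R := fun (_ : ℕ) u => u[i]? = some a)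
    hR.computablePred.to_re
  refine ⟨s 0, fun p => ?_⟩
  simp only [openSet, Set.mem_ofPred_eq, hs, getElem?_initSeg_eq_some]
  exact ⟨fun ⟨_, _, h⟩ => h, fun h => ⟨i + 1, i.lt_succ_self, h⟩⟩

theorem jump_eq_one_iff {q : Baire} {n : ℕ} : jump q n = 1 ↔ q ∈ openSet n := by
  simp [jump]

theorem jump_injective : Function.Injective jump := by
  intro q r h
  funext i
  obtain ⟨n, hn⟩ := exists_mem_openSet_iff_apply_eq i (q i)
  have hr : r ∈ openSet n := by
    rw [← jump_eq_one_iff, ← h, jump_eq_one_iff, hn]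
  exact ((hn r).1 hr).symm

theorem mem_lowMap_iff {x : ℕ → Baire} {q : Baire} :
    q ∈ lowMap x ↔ ∀ n, ∀ᶠ i in atTop, x i n = jump q n := by
  simp [lowMap, tendsto_pi_nhds, nhds_discrete]

theorem lowMap_subsingleton (x : ℕ → Baire) : (lowMap x).Subsingleton :=
  fun _ hq _ hr => jump_injective (tendsto_nhds_unique hq hr)

end Jump

section Names

theorem mem_reprCantor {p x : Cantor} : x ∈ reprCantor.toPFun p ↔ x = p :=
  Representation.mem_ofInjective id Function.injective_id p x

theorem mem_reprBaire {p : Cantor} {x : Baire} : x ∈ reprBaire.toPFun p ↔ graphName x = p :=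
  Representation.mem_ofInjective _ graphName_injective p x

theorem mem_reprBaireSeq {p : Cantor} {x : ℕ → Baire} :
    x ∈ reprBaireSeq.toPFun p ↔ graphName (join x) = p :=
  Representation.mem_ofInjective _ (graphName_injective.comp join_injective) p x

/-- The part of the name `graphName q` that is computed from an initial segment `w` of `q`. -/
def graphWord (w : List ℕ) : List Bool :=
  (List.range w.length).map fun k => decide (w[k.unpair.1]? = some k.unpair.2)

theorem primrec_graphWord : Primrec graphWord := by
  refine Primrec.list_map (Primrec.list_range.comp Primrec.list_length) ?_
  have hk : Primrec fun x : List ℕ × ℕ => x.2.unpair := Primrec.unpair.comp .snd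
  exact (Primrec.eq.comp (Primrec.list_getElem?.comp .fst (.comp .fst hk))
    (Primrec.option_some.comp (.comp .snd hk))).decide

theorem computes_graphWord (q : Baire) : Computes graphWord q (graphName q) := by
  have hword (k : ℕ) : graphWord (initSeg q k) = initSeg (graphName q) k := by
    rw [graphWord, length_initSeg]
    refine List.map_congr_left fun i hi => ?_
    rw [getElem?_initSeg ((Nat.unpair_left_le i).trans_lt (List.mem_range.1 hi))]
    simp [graphName]
  refine ⟨fun k => by rw [hword, length_initSeg], ?_⟩
  simpa only [hword, length_initSeg] using! tendsto_id

/-- The standard embedding of Cantor space into Baire space. -/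
def toBaire (p : Cantor) : Baire := Bool.toNat ∘ p

/-- The left inverse of `toBaire` on names: the `n`-th bit of `p` is `false` if and only if `(n, 0)`
belongs to the graph of `toBaire p`. -/
def ofGraphName (r : Cantor) : Cantor := fun n => !r (Nat.pair n 0)

theorem ofGraphName_graphName_toBaire (p : Cantor) : ofGraphName (graphName (toBaire p)) = p := by
  funext n
  cases h : p n <;> simp [ofGraphName, graphName, toBaire, h]

theorem isComputable_ofGraphName : IsComputable (ofGraphName : Cantor →. Cantor) := by
  refine isComputable_of_bit (N := Nat.sqrt) (b := fun u k => !(u[Nat.pair k 0]?).getD false)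
    Primrec.nat_sqrt.to_comp (fun _ _ => Nat.sqrt_le_sqrt) (fun n => ⟨n * n, (Nat.sqrt_eq n).ge⟩)
    ?_ fun p l k hk => ?_
  · have hpair : Primrec fun x : List Bool × ℕ => Nat.pair x.2 0 :=
      Primrec₂.natPair.comp .snd (.const 0)
    exact (Primrec.not.comp (Primrec.option_getD.comp
      (Primrec.list_getElem?.comp .fst hpair) (.const false))).to_comp
  · have hlt : Nat.pair k 0 < l := calc
      Nat.pair k 0 < (k + 1) ^ 2 := by simpa using Nat.pair_lt_max_add_one_sq k 0
      _ ≤ l := Nat.le_sqrt'.1 hk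
    rw [getElem?_initSeg hlt, Option.getD_some, ofGraphName]

end Names

section LimitDecidable

variable {X : Set Cantor} {D : ℕ → Set Cantor}

/-- Uniform decidability in the limit: reading longer and longer initial segments of a point of
`X`, a single algorithm guesses whether the point belongs to `D n`, and its guesses are eventually
correct. -/
def LimitDecidable (X : Set Cantor) (D : ℕ → Set Cantor) : Prop :=
  ∃ d : ℕ → List Bool → Bool, Computable₂ d ∧
    ∀ n, ∀ p ∈ X, ∀ᶠ i in atTop, (d n (initSeg p i) = true ↔ p ∈ D n)

theorem LimitDecidable.comp {s : ℕ → ℕ} (h : LimitDecidable X D) (hs : Computable s) :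
    LimitDecidable X fun n => D (s n) := by
  obtain ⟨d, hd, hlim⟩ := h
  exact ⟨fun n => d (s n), hd.comp (hs.comp .fst) .snd, fun n => hlim (s n)⟩

/-- The word `u` is seen to lie in the `l`-th open set of the `m`-th sequence by a search bounded by
the length of `u`. -/
def Entered (m l : ℕ) (u : List Bool) : Prop :=
  ∃ k < u.length + 1, HaltsBy u.length m (l, u.take k)

theorem primrecPred_entered :
    PrimrecPred fun x : (ℕ × ℕ) × List Bool => Entered x.1.1 x.1.2 x.2 := by
  have hhalts : PrimrecRel fun (k : ℕ) (x : (ℕ × ℕ) × List Bool) =>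
      HaltsBy x.2.length x.1.1 (x.1.2, x.2.take k) := by
    have hu : Primrec fun y : ℕ × (ℕ × ℕ) × List Bool => y.2.2 := .comp .snd .snd
    have hx : Primrec fun y : ℕ × (ℕ × ℕ) × List Bool => y.2.1 := .comp .fst .snd
    exact primrecPred_haltsBy.comp (.pair (.pair (Primrec.list_length.comp hu) (.comp .fst hx))
      (.pair (.comp .snd hx) (Primrec.list_take.comp .fst hu)))
  exact (primrecRel_exists_lt hhalts).comp
    (Primrec.succ.comp (Primrec.list_length.comp .snd)) .id

theorem entered_initSeg {m l i : ℕ} {p : Cantor} :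
    Entered m l (initSeg p i) ↔ ∃ k ≤ i, HaltsBy i m (l, initSeg p k) := by
  simp only [Entered, length_initSeg, Nat.lt_succ_iff]
  exact exists_congr fun k => and_congr_right fun hk => by rw [take_initSeg hk]

theorem mem_openSeq_of_entered {m l i : ℕ} {p : Cantor} (h : Entered m l (initSeg p i)) :
    p ∈ openSeq m l := by
  obtain ⟨k, -, hk⟩ := entered_initSeg.1 h
  exact ⟨k, wDom_iff_exists_haltsBy.2 ⟨i, hk⟩⟩

theorem eventually_entered {m l : ℕ} {p : Cantor} (h : p ∈ openSeq m l) :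
    ∀ᶠ i in atTop, Entered m l (initSeg p i) := by
  obtain ⟨k, hk⟩ := h
  obtain ⟨j, hj⟩ := wDom_iff_exists_haltsBy.1 hk
  filter_upwards [eventually_ge_atTop j, eventually_ge_atTop k] with i hji hki
  exact entered_initSeg.2 ⟨k, hki, hj.mono hji⟩

theorem eventually_forall_le_entered {m : ℕ} {p : Cantor} (h : ∀ l, p ∈ openSeq m l) (l : ℕ) :
    ∀ᶠ i in atTop, ∀ l' ≤ l, Entered m l' (initSeg p i) :=
  (eventually_all_finite (Set.finite_Iic l)).2 fun l' _ => eventually_entered (h l')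

/-- The guess, after reading `u`, that a point belongs to the `Δ⁰₂` set `⋃ i, A_i = ⋂ i, V_i` with
index `m`: for some `l`, the point has not yet left `A_l`, but it has entered `V_0, …, V_l`. -/
def DeltaGuess (m : ℕ) (u : List Bool) : Prop :=
  ∃ l < u.length, ¬Entered m.unpair.1 l u ∧ ∀ l' < l + 1, Entered m.unpair.2 l' u

theorem primrecRel_deltaGuess : PrimrecRel DeltaGuess := by
  have hleft : PrimrecRel fun (l : ℕ) (x : ℕ × List Bool) => Entered x.1.unpair.1 l x.2 :=
    primrecPred_entered.comp (.pair (.pair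
      (.comp .fst (Primrec.unpair.comp (.comp .fst .snd))) .fst) (.comp .snd .snd))
  have hright : PrimrecRel fun (l : ℕ) (x : ℕ × List Bool) => Entered x.1.unpair.2 l x.2 :=
    primrecPred_entered.comp (.pair (.pair
      (.comp .snd (Primrec.unpair.comp (.comp .fst .snd))) .fst) (.comp .snd .snd))
  have hbody : PrimrecRel fun (l : ℕ) (x : ℕ × List Bool) =>
      ¬Entered x.1.unpair.1 l x.2 ∧ ∀ l' < l + 1, Entered x.1.unpair.2 l' x.2 :=
    hleft.not.and ((primrecRel_forall_lt hright).comp (Primrec.succ.comp .fst) .snd)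
  exact (primrecRel_exists_lt hbody).comp (Primrec.list_length.comp .snd) .id

theorem IsDeltaIndex.eventually_deltaGuess_iff {X D : Set Cantor} {m : ℕ}
    (h : IsDeltaIndex X m D) {p : Cantor} (hp : p ∈ X) :
    ∀ᶠ i in atTop, (DeltaGuess m (initSeg p i) ↔ p ∈ D) := by
  have hA : p ∈ D ↔ ∃ i, p ∉ openSeq m.unpair.1 i := (Set.ext_iff.1 h.1 p).trans (by simp [hp])
  have hV : p ∈ D ↔ ∀ i, p ∈ openSeq m.unpair.2 i := (Set.ext_iff.1 h.2 p).trans (by simp [hp])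
  by_cases hD : p ∈ D
  · obtain ⟨l, hl⟩ := hA.1 hD
    filter_upwards [eventually_gt_atTop l, eventually_forall_le_entered (hV.1 hD) l] with i hi hall
    refine iff_of_true ⟨l, by rwa [length_initSeg], mt mem_openSeq_of_entered hl, ?_⟩ hD
    exact fun l' hl' => hall l' (Nat.lt_succ_iff.1 hl')
  · obtain ⟨l, hl⟩ := not_forall.1 (mt hV.2 hD)
    have hleave : ∀ i, p ∈ openSeq m.unpair.1 i := by simpa using mt hA.2 hD
    filter_upwards [eventually_forall_le_entered hleave l] with i hall
    refine iff_of_false ?_ hD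
    rintro ⟨l', -, hnot, hent⟩
    rcases le_or_gt l' l with hle | hlt
    · exact hnot (hall l' hle)
    · exact hl (mem_openSeq_of_entered (hent l (hlt.trans l'.lt_succ_self)))

theorem limitDecidable_of_isDeltaIndex {g : ℕ → ℕ} (hg : Computable g)
    (h : ∀ n, IsDeltaIndex X (g n) (D n)) : LimitDecidable X D := by
  classical
  refine ⟨fun n u => decide (DeltaGuess (g n) u), ?_, fun n p hp => ?_⟩
  · exact (computablePred_comp primrecRel_deltaGuess.computablePred
      (Computable.pair (hg.comp .fst) .snd)).decide
  · simpa only [decide_eq_true_eq] using (h n).eventually_deltaGuess_iff hp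

theorem exists_computable_mem_openSeq_iff {d : ℕ → List Bool → Bool} (hd : Computable₂ d)
    (b : Bool) : ∃ a : ℕ → ℕ, Computable a ∧
      ∀ n i p, p ∈ openSeq (a n) i ↔ ∃ j ≥ i, d n (initSeg p j) = b := by
  have hR : ComputablePred fun x : ℕ × ℕ × List Bool => x.2.1 ≤ x.2.2.length ∧ d x.1 x.2.2 = b := by
    have hpred : PrimrecPred fun y : (ℕ × ℕ) × Bool => y.1.1 ≤ y.1.2 ∧ y.2 = b :=
      (Primrec.nat_le.comp (.comp .fst .fst) (.comp .snd .fst)).and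
        (Primrec.eq.comp .snd (.const b))
    exact computablePred_comp hpred.computablePred
      (f := fun x : ℕ × ℕ × List Bool => ((x.2.1, x.2.2.length), d x.1 x.2.2))
      (.pair (.pair (.comp .fst .snd) (Computable.list_length.comp (.comp .snd .snd)))
        (hd.comp .fst (.comp .snd .snd)))
  obtain ⟨a, ha, h⟩ := exists_computable_wDom_iff
    (R := fun n (x : ℕ × List Bool) => x.1 ≤ x.2.length ∧ d n x.2 = b) hR.to_re
  exact ⟨a, ha, fun n i p => by simp only [openSeq, Set.mem_ofPred_eq, h, length_initSeg]⟩

theorem LimitDecidable.exists_isDeltaIndex (h : LimitDecidable X D) (hD : ∀ n, D n ⊆ X) :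
    ∃ g : ℕ → ℕ, Computable g ∧ ∀ n, IsDeltaIndex X (g n) (D n) := by
  obtain ⟨d, hd, hlim⟩ := h
  obtain ⟨a, ha, hleave⟩ := exists_computable_mem_openSeq_iff hd false
  obtain ⟨v, hv, henter⟩ := exists_computable_mem_openSeq_iff hd true
  refine ⟨fun n => Nat.pair (a n) (v n), Primrec₂.natPair.to_comp.comp ha hv, fun n => ?_⟩
  suffices ∀ p ∈ X, (p ∈ D n ↔ ∃ i, p ∉ openSeq (a n) i) ∧
      (p ∈ D n ↔ ∀ i, p ∈ openSeq (v n) i) by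
    rw [IsDeltaIndex, Nat.unpair_pair]
    constructor <;> ext p
    · exact ⟨fun h => ⟨hD n h, (this p (hD n h)).1.1 h⟩, fun h => (this p h.1).1.2 h.2⟩
    · exact ⟨fun h => ⟨hD n h, (this p (hD n h)).2.1 h⟩, fun h => (this p h.1).2.2 h.2⟩
  intro p hp
  constructor
  · calc p ∈ D n ↔ ∀ᶠ j in atTop, d n (initSeg p j) = true := by
          rw [eventually_congr (hlim n p hp), eventually_const]
      _ ↔ ∃ i, p ∉ openSeq (a n) i := by simp [eventually_atTop, hleave]
  · calc p ∈ D n ↔ ∃ᶠ j in atTop, d n (initSeg p j) = true := by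
          rw [frequently_congr (hlim n p hp), frequently_const]
      _ ↔ ∀ i, p ∈ openSeq (v n) i := by simp only [frequently_atTop, henter]

theorem isMarkovDeltaMeasurable_iff_limitDecidable {f : Cantor →. Cantor} :
    IsMarkovDeltaMeasurable f ↔ LimitDecidable f.Dom fun n => f.preimage (openSet n) := by
  constructor
  · rintro ⟨P, hP, h⟩
    choose g hg hidx using h
    have hcomp : Computable g := (Partrec.nat_iff.2 hP).of_eq fun n => Part.eq_some_iff.2 (hg n)
    exact limitDecidable_of_isDeltaIndex hcomp hidx
  · intro h
    obtain ⟨g, hg, hidx⟩ := h.exists_isDeltaIndex fun n => f.preimage_subset_dom _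
    exact ⟨_, Partrec.nat_iff.1 hg.partrec, fun n => ⟨g n, Part.mem_some _, hidx n⟩⟩

end LimitDecidable

section StrongReducibility

variable {X Y U V : Type}

theorem exists_isRealizer_forall_mem (δU : Representation U) (δV : Representation V)
    (g : MultiMap U V) :
    ∃ G : Cantor →. Cantor, IsRealizer δU δV G g ∧
      ∀ r, ∀ w ∈ G r, ∃ u ∈ δU.toPFun r, ∃ v ∈ δV.toPFun w, v ∈ g u := by
  -- `G` diverges off the names of points of the domain of `g`, so wherever it is defined its input
  -- is such a name.
  let R (r w : Cantor) : Prop := ∃ u ∈ δU.toPFun r, ∃ v ∈ δV.toPFun w, v ∈ g u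
  refine ⟨fun r => ⟨∃ w, R r w, fun h => h.choose⟩, ?_, ?_⟩
  · rintro r u hu ⟨v, hv⟩
    obtain ⟨w, hw⟩ := δV.surj v
    have h : ∃ w, R r w := ⟨w, u, hu, v, hw, hv⟩
    obtain ⟨u', hu', hval⟩ := h.choose_spec
    obtain rfl := Part.mem_unique hu' hu
    exact ⟨h.choose, ⟨h, rfl⟩, hval⟩
  · rintro r w ⟨h, rfl⟩
    exact h.choose_spec

theorem StrongWeihrauchLE.exists_computes {δX : Representation X} {δY : Representation Y}
    {δU : Representation U} {δV : Representation V} {f : MultiMap X Y} {g : MultiMap U V}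
    (h : StrongWeihrauchLE δX δY δU δV f g) :
    ∃ MH MK : List Bool → List Bool, Computable MH ∧ Computable MK ∧
      ∀ p, ∀ x ∈ δX.toPFun p, (f x).Nonempty →
        ∃ r, Computes MK p r ∧ ∃ u ∈ δU.toPFun r, ∃ w, ∃ v ∈ δV.toPFun w, v ∈ g u ∧
          ∃ z, Computes MH w z ∧ ∃ y ∈ δY.toPFun z, y ∈ f x := by
  obtain ⟨H, K, hH, hK, hred⟩ := h
  obtain ⟨MH, hMH, hHcomputes⟩ := hH.exists_computes
  obtain ⟨MK, hMK, hKcomputes⟩ := hK.exists_computes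
  obtain ⟨G, hG, hGmem⟩ := exists_isRealizer_forall_mem δU δV g
  refine ⟨MH, MK, hMH, hMK, fun p x hx hne => ?_⟩
  obtain ⟨z, hz, hy⟩ := hred G hG p x hx hne
  rw [PFun.comp_apply, PFun.comp_apply] at hz
  obtain ⟨w, hw, hz⟩ := Part.mem_bind_iff.1 hz
  obtain ⟨r, hr, hw⟩ := Part.mem_bind_iff.1 hw
  obtain ⟨u, hu, v, hv, hvu⟩ := hGmem r w hw
  exact ⟨r, hKcomputes p r hr, u, hu, w, v, hv, hvu, z, hHcomputes w z hz, hy⟩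

end StrongReducibility

section Reductions

/-- The position, in the name of a sequence `x` in Baire space, of the bit that tells whether
`x j m = 1`. -/
def bitPos (j m : ℕ) : ℕ := Nat.pair (Nat.pair j m) 1

theorem primrec₂_bitPos : Primrec₂ bitPos :=
  Primrec₂.natPair.comp (Primrec₂.natPair.comp .fst .snd) (.const 1)

theorem graphName_join_bitPos (x : ℕ → Baire) (j m : ℕ) :
    graphName (join x) (bitPos j m) = decide (x j m = 1) := by
  simp [graphName, join, bitPos]

/-- The guess whether `lim x j m = 1` as `j → ∞`, based on a finite part `w` of the name of the
sequence `x`: some bit of `w` tells that `x j m = 1`, and none tells that `x k m ≠ 1` for a later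
`k`. -/
def LimitGuess (m : ℕ) (w : List Bool) : Prop :=
  ∃ j < w.length, w[bitPos j m]? = some true ∧
    ∀ k < w.length, ¬(j < k ∧ w[bitPos k m]? = some false)

theorem primrecRel_limitGuess : PrimrecRel LimitGuess := by
  have hbit (b : Bool) : PrimrecRel fun (k : ℕ) (y : ℕ × ℕ × List Bool) =>
      y.2.2[bitPos k y.2.1]? = some b :=
    Primrec.eq.comp (Primrec.list_getElem?.comp (.comp .snd (.comp .snd .snd))
      (primrec₂_bitPos.comp .fst (.comp .fst (.comp .snd .snd)))) (.const (some b))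
  have hlate : PrimrecRel fun (k : ℕ) (y : ℕ × ℕ × List Bool) =>
      ¬(y.1 < k ∧ y.2.2[bitPos k y.2.1]? = some false) :=
    ((Primrec.nat_lt.comp (.comp .fst .snd) .fst).and (hbit false)).not
  have hbody : PrimrecRel fun (j : ℕ) (x : ℕ × List Bool) =>
      x.2[bitPos j x.1]? = some true ∧
        ∀ k < x.2.length, ¬(j < k ∧ x.2[bitPos k x.1]? = some false) :=
    ((hbit true).comp .fst (.pair .fst .snd)).and
      ((primrecRel_forall_lt hlate).comp (Primrec.list_length.comp (.comp .snd .snd)) .id)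
  exact (primrecRel_exists_lt hbody).comp (Primrec.list_length.comp .snd) .id

theorem eventually_limitGuess_iff {x : ℕ → Baire} {m c : ℕ} (h : ∀ᶠ j in atTop, x j m = c) :
    ∀ᶠ l in atTop, (LimitGuess m (initSeg (graphName (join x)) l) ↔ c = 1) := by
  obtain ⟨N, hN⟩ := eventually_atTop.1 h
  filter_upwards [eventually_gt_atTop N, eventually_gt_atTop (bitPos N m)] with l hl hpos
  simp only [LimitGuess, getElem?_initSeg_eq_some, graphName_join_bitPos, length_initSeg,
    decide_eq_true_eq, decide_eq_false_iff_not]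
  constructor
  · rintro ⟨j, -, ⟨-, hj⟩, hlast⟩
    by_contra hc
    rcases le_or_gt N j with hNj | hjN
    · exact hc ((hN j hNj).symm.trans hj)
    · exact hlast N hl ⟨hjN, hpos, (hN N le_rfl).trans_ne hc⟩
  · rintro rfl
    exact ⟨N, hl, ⟨hpos, hN N le_rfl⟩, fun k _ hk => hk.2.2 (hN k hk.1.le)⟩

/-- The sequence in Baire space whose `i`-th member collects the guesses that `d` makes after
reading `i` bits of `p`. -/
def guessSeq (d : ℕ → List Bool → Bool) (p : Cantor) : ℕ → Baire :=
  fun i n => (d n (initSeg p i)).toNat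

theorem mem_lowMap_guessSeq {d : ℕ → List Bool → Bool} {p : Cantor} {q : Baire}
    (h : ∀ n, ∀ᶠ i in atTop, (d n (initSeg p i) = true ↔ q ∈ openSet n)) :
    q ∈ lowMap (guessSeq d p) := by
  refine mem_lowMap_iff.2 fun n => (h n).mono fun i hi => ?_
  by_cases hq : q ∈ openSet n
  · simp [guessSeq, jump, hq, hi.2 hq]
  · simp [guessSeq, jump, hq, Bool.eq_false_iff.2 (mt hi.1 hq)]

theorem isComputable_guessSeq {d : ℕ → List Bool → Bool} (hd : Computable₂ d) :
    IsComputable ((fun p => graphName (join (guessSeq d p)) : Cantor → Cantor) :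
      Cantor →. Cantor) := by
  refine isComputable_of_bit (N := id) (b := fun u k =>
      decide ((d k.unpair.1.unpair.2 (u.take k.unpair.1.unpair.1)).toNat = k.unpair.2))
    .id monotone_id (fun n => ⟨n, le_rfl⟩) ?_ fun p l k hk => ?_
  · have hpos : Computable fun x : List Bool × ℕ => x.2.unpair.1.unpair :=
      Computable.unpair.comp (.comp .fst (Computable.unpair.comp .snd))
    have hguess : Computable fun x : List Bool × ℕ =>
        d x.2.unpair.1.unpair.2 (x.1.take x.2.unpair.1.unpair.1) :=
      hd.comp (.comp .snd hpos) (Primrec.list_take.to_comp.comp (.comp .fst hpos) .fst)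
    have heq : PrimrecRel fun (b : Bool) (n : ℕ) => b.toNat = n :=
      Primrec.eq.comp ((Primrec.dom_bool Bool.toNat).comp .fst) .snd
    exact (computablePred_comp heq.computablePred
      (hguess.pair (.comp .snd (Computable.unpair.comp .snd)))).decide
  · have hstage : k.unpair.1.unpair.1 ≤ l :=
      ((Nat.unpair_left_le _).trans (Nat.unpair_left_le k)).trans hk.le
    rw [take_initSeg hstage]
    rfl

theorem mem_preimage_iff_of_mem {X Y : Type*} {f : X →. Y} {S : Set Y} {x : X} {y : Y}
    (hy : y ∈ f x) : x ∈ f.preimage S ↔ y ∈ S := by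
  rw [PFun.mem_preimage]
  exact ⟨fun ⟨z, hz, hzx⟩ => Part.mem_unique hy hzx ▸ hz, fun h => ⟨y, h, hy⟩⟩

variable {f : Cantor →. Cantor}

theorem limitDecidable_of_strongWeihrauchLE
    (h : StrongWeihrauchLE reprCantor reprCantor reprBaireSeq reprBaire (toMulti f) lowMap) :
    LimitDecidable f.Dom fun n => f.preimage (openSet n) := by
  classical
  obtain ⟨MH, MK, hMH, hMK, hred⟩ := h.exists_computes
  obtain ⟨s, hs, hopen⟩ := exists_computable_mem_openSet_iff
    (hMH.comp primrec_graphWord.to_comp)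
  refine ⟨fun n u => decide (LimitGuess (s n) (MK u)), ?_, fun n p hp => ?_⟩
  · exact (computablePred_comp primrecRel_limitGuess.computablePred
      (Computable.pair (hs.comp .fst) (hMK.comp .snd))).decide
  obtain ⟨r, hr, x, hx, w, q, hq, hlow, y, hy, y', hy', hf⟩ :=
    hred p p (mem_reprCantor.2 rfl) ((PFun.mem_dom f p).1 hp)
  obtain rfl := mem_reprBaireSeq.1 hx
  obtain rfl := mem_reprBaire.1 hq
  obtain rfl := mem_reprCantor.1 hy'
  have hmem : jump q (s n) = 1 ↔ p ∈ f.preimage (openSet n) := by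
    rw [jump_eq_one_iff, hopen n q y' (hy.comp (computes_graphWord q)), mem_preimage_iff_of_mem hf]
  have hguess := hr.tendsto_length.eventually
    (eventually_limitGuess_iff (mem_lowMap_iff.1 hlow (s n)))
  filter_upwards [hguess] with i hi
  rw [decide_eq_true_eq, hr.eq_initSeg, hi, hmem]

theorem strongWeihrauchLE_of_limitDecidable
    (h : LimitDecidable f.Dom fun n => f.preimage (openSet n)) :
    StrongWeihrauchLE reprCantor reprCantor reprBaireSeq reprBaire (toMulti f) lowMap := by
  have hmap : Primrec (List.map Bool.toNat) :=
    Primrec.list_map .id ((Primrec.dom_bool Bool.toNat).comp Primrec.snd).to₂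
  obtain ⟨t, ht, hopen⟩ := exists_computable_mem_openSet_iff hmap.to_comp
  obtain ⟨d, hd, hlim⟩ := h.comp ht
  refine ⟨_, _, isComputable_ofGraphName, isComputable_guessSeq hd, ?_⟩
  rintro G hG p x hx ⟨y, hy⟩
  obtain rfl := mem_reprCantor.1 hx
  have hlow : toBaire y ∈ lowMap (guessSeq d x) := by
    refine mem_lowMap_guessSeq fun n => ?_
    have hmem : x ∈ f.preimage (openSet (t n)) ↔ toBaire y ∈ openSet n := by
      rw [mem_preimage_iff_of_mem hy, hopen n y (toBaire y) (computes_map _ y)]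
    simpa only [hmem] using hlim n x ((PFun.mem_dom f x).2 ⟨y, hy⟩)
  obtain ⟨w, hw, q, hq, hqlow⟩ := hG _ _ (mem_reprBaireSeq.2 rfl) ⟨_, hlow⟩
  obtain rfl := lowMap_subsingleton _ hlow hqlow
  obtain rfl := mem_reprBaire.1 hq
  refine ⟨y, ?_, y, mem_reprCantor.2 rfl, hy⟩
  rw [PFun.comp_apply, PFun.comp_apply]
  refine Part.mem_bind_iff.2 ⟨_, Part.mem_bind_iff.2 ⟨_, Part.mem_some _, hw⟩, ?_⟩
  simp [ofGraphName_graphName_toBaire]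

end Reductions

end TTE

theorem corollary14 (f : TTE.Cantor →. TTE.Cantor) :
    TTE.IsMarkovDeltaMeasurable f ↔
      TTE.StrongWeihrauchLE TTE.reprCantor TTE.reprCantor TTE.reprBaireSeq TTE.reprBaire
        (TTE.toMulti f) TTE.lowMap :=
  TTE.isMarkovDeltaMeasurable_iff_limitDecidable.trans
    ⟨TTE.strongWeihrauchLE_of_limitDecidable, TTE.limitDecidable_of_strongWeihrauchLE⟩
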